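/- Write $\mathcal F$ for the set of non-empty finite subsets of $\mathbb N$, and $\alpha<\beta$ if $\max\alpha<\min\beta$ ($\alpha,\beta\in\mathcal F$). An IP-ring is a set of the form $\mathcal F^{(1)}=\{\bigcup_{i\in\beta}\alpha_i:\beta\in\mathcal F\}$, where $\alpha_1<\alpha_2<\cdots$ is a sequence in $\mathcal F$. Let $A=\{n_\alpha\}_{\alpha\in\mathcal F}$ be an IP-set in $\mathbb Z$: $n_\alpha=\sum_{i\in\alpha}n_i$ for a sequence $(n_i)$ of (not necessarily distinct) integers. A set $B\subseteq\mathbb Z$ is called a $\mathcal G_A^*$-set if for every IP-ring $\mathcal F^{(1)}$ there is $\alpha\in\mathcal F^{(1)}$ with $n_\alpha\in B$. **Theorem 3.2.** Let $\Gamma$ be an abelian Hausdorff topological group with identity $e_\Gamma$, acting continuously on a compact metric space $X$. Assume that for every $T\in\Gamma$ with $T\ne e_\Gamma$ the system $(X,T)$ is minimal (every orbit $\{T^nx:n\in\mathbb Z\}$ is dense in $X$) and mixing along $A$ (for all non-empty open $U,V\subseteq X$ the set $\{n\in\mathbb Z:U\cap T^{-n}V\neq\emptyset\}$ is a $\mathcal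 G_A^*$-set). Let $d,k\in\mathbb N$, let $T_1,\dots,T_d\in\Gamma$, and let $p_{i,j}$ ($1\le i\le k$, $1\le j\le d$) be integral polynomials, i.e. polynomials taking integer values at the integers. Put $$g_i(n)=T_1^{p_{i,1}(n)}\cdots T_d^{p_{i,d}(n)},\qquad i=1,\dots,k,$$ and suppose that each $g_i(n)$, and each $g_i(n)g_j(n)^{-1}$ with $i\ne j$, depends nontrivially on $n$, i.e. is a non-constant map $\mathbb Z\to\Gamma$. Then for all non-empty open sets $U,V_1,\dots,V_k\subseteq X$ the set $$\{n\in\mathbb Z:U\cap g_1(n)^{-1}V_1\cap\cdots\cap g_k(n)^{-1}V_k\neq\emptyset\}$$ is a $\mathcal G_A^*$-set. -/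

import Mathlib

namespace IPMixing

/-- `α < β` for finite sets of indices: every element of `α` is smaller than every element of `β`
(for non-empty sets: `max α < min β`). -/
def BlockLT (α β : Finset ℕ) : Prop := ∀ i ∈ α, ∀ j ∈ β, i < j

/-- An IP-ring: the set of all unions `⋃_{i ∈ β} a i`, with `β` ranging over the non-empty finite
sets of indices, of a sequence `a 0 < a 1 < a 2 < ⋯` of non-empty finite sets. -/
def IsIPRing (R : Set (Finset ℕ)) : Prop :=
  ∃ a : ℕ → Finset ℕ, (∀ i, (a i).Nonempty) ∧ (∀ i, BlockLT (a i) (a (i + 1))) ∧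
    R = {γ | ∃ β : Finset ℕ, β.Nonempty ∧ γ = β.biUnion a}

/-- The element `n_α = ∑_{i ∈ α} n_i` of the IP-set generated by the sequence `n`. -/
def ipSum (n : ℕ → ℤ) (α : Finset ℕ) : ℤ := ∑ i ∈ α, n i

/-- The family `𝒢_A` generated by the IP-subsets `{n_α : α ∈ R}`, `R` an IP-ring, of the IP-set
`A = {n_α}` generated by the sequence `n`. -/
def ipFamily (n : ℕ → ℤ) : Set (Set ℤ) :=
  {B | ∃ R : Set (Finset ℕ), IsIPRing R ∧ ipSum n '' R ⊆ B}

/-- The dual of a family of subsets of `ℤ`: the sets that meet every member of the family. -/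
def dualFamily (G : Set (Set ℤ)) : Set (Set ℤ) :=
  {B | ∀ A ∈ G, (B ∩ A).Nonempty}

/-- An integral polynomial, viewed as a function `ℤ → ℤ`. The coefficients are taken in `ℚ`; a
complex polynomial with integer values at the integers has rational coefficients anyway. -/
def IsIntegralPolynomial (f : ℤ → ℤ) : Prop :=
  ∃ q : Polynomial ℚ, ∀ m : ℤ, q.eval (m : ℚ) = (f m : ℚ)

/-- The map `g(m) = T_1^{p_1(m)} ⋯ T_d^{p_d(m)}`. -/
def gammaPoly {Γ : Type*} [CommGroup Γ] {d : ℕ} (T : Fin d → Γ) (p : Fin d → ℤ → ℤ) (m : ℤ) : Γ :=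
  ∏ j, T j ^ p j m

/-- `g` is a non-constant mapping of `ℤ` into `Γ`. -/
def DependsNontrivially {Γ : Type*} (g : ℤ → Γ) : Prop := ∃ m m' : ℤ, g m ≠ g m'

/-- `(X, T)` is minimal: `X` is minimal for the action of the cyclic group `{T ^ m : m ∈ ℤ}`,
i.e. every orbit `{T ^ m • x : m ∈ ℤ}` is dense. -/
def IsMinimalElement {Γ : Type*} [Group Γ] (X : Type*) [TopologicalSpace X] [MulAction Γ X]
    (T : Γ) : Prop :=
  MulAction.IsMinimal (Subgroup.zpowers T) X

/-- `(X, T)` is mixing along the IP-set generated by the sequence `n`: for all non-empty open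
`U`, `V`, the set `{m : U ∩ T^{-m} V ≠ ∅}` belongs to `𝒢_A^*`. -/
def IsMixingAlong {Γ : Type*} [Group Γ] (X : Type*) [TopologicalSpace X] [MulAction Γ X]
    (n : ℕ → ℤ) (T : Γ) : Prop :=
  ∀ U V : Set X, IsOpen U → U.Nonempty → IsOpen V → V.Nonempty →
    {m : ℤ | (U ∩ (fun x : X => T ^ m • x) ⁻¹' V).Nonempty} ∈ dualFamily (ipFamily n)

end IPMixing

/-!
The proof combines idempotent ultrafilters with polynomial exhaustion (PET induction).

Given an IP-ring `R`, the Galvin–Glazer argument yields an idempotent ultrafilter `p` on `ℤ` that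
contains `{n_α : α ∈ R}` and every member of `𝒢_A^*` (`exists_idempotent_ultrafilter`). It therefore
suffices to show that, if every `T ≠ 1` in `Γ` is mixing along `p`, then the return set of the family
`g_1, …, g_k` belongs to `p`. Working with `p` makes finite intersections of return sets harmless, and
it forces `Γ` to be torsion-free and `p` to be non-principal when `X` has two points
and `Γ` is non-trivial; both facts keep translates of non-affine maps apart.

The maps `g_i` are polynomial in the sense that their iterated differences of some order are
constant (`polyMaps`). The main result `IsMixingUltrafilter.eventually_exists` is proved by induction
on the weight of the family, i.e. on the numbers of leading terms in each degree. Suppose the return set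
`{m : ∃ x ∈ U, ∀ i, g_i(m) x ∈ V_i}` is not in `p`, and call `B` its complement. By minimality and
compactness there is a finite `J ⊆ Γ` such that every `y ∈ X` satisfies `s y ∈ U` for some `s ∈ J`.
By idempotence there are `k_s ∈ ℤ` with `k_s + m ∈ B` for `p`-many `m`. If some such `m` and some
single point `y` satisfy `g_i(m + k_s) s y ∈ V_i` for all `i` and all `s ∈ J`, then choosing `s` with
`s y ∈ U` contradicts `k_s + m ∈ B`. To find `m` and `y`, consider the maps `m ↦ g_i(m + k_s)`. If
`g_i` is not affine, they differ for different `s` by more than a constant provided the `k_s` are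
well chosen; if `g_i(m) = c S^m`, they differ by the constants `S^{k_s}`, and mixing of `S` along
`p` allows `V_i` to be replaced by one open set `W_i` with `s S^{k_s} W_i ⊆ V_i` for all `s`
(`IsMixingUltrafilter.exists_shifts`). Dividing the resulting family by one of its members of minimal
degree lowers the weight (`weight_lt`), so the induction hypothesis applies.
-/

namespace IPMixing

open Filter Hindman

universe u

/-! ### Idempotent ultrafilters along an IP-ring -/

/-- Finite sets of indices under union of consecutive blocks, with an absorbing element `none` that
is the product of two sets not in the relation `BlockLT`. Making the partial operation total in this
way lets the Galvin–Glazer argument for semigroups produce IP-rings. -/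
def BlockSemigroup : Type := Option (Finset ℕ)

namespace BlockSemigroup

open Classical in
/-- The product of `BlockSemigroup`: the union of `α < β`, and `none` otherwise. -/
noncomputable def mul : BlockSemigroup → BlockSemigroup → BlockSemigroup
  | some α, some β => if BlockLT α β then some (α ∪ β) else none
  | _, _ => none

noncomputable instance : Mul BlockSemigroup := ⟨mul⟩

/-- A finite set of indices as an element of `BlockSemigroup`. -/
def of (α : Finset ℕ) : BlockSemigroup := some α

/-- The absorbing element of `BlockSemigroup`. -/
def absorbing : BlockSemigroup := none

theorem of_ne_absorbing (α : Finset ℕ) : of α ≠ absorbing := Option.some_ne_none α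

theorem mul_absorbing (x : BlockSemigroup) : x * absorbing = absorbing := by
  cases x <;> rfl

theorem of_mul_of {α β : Finset ℕ} (h : BlockLT α β) : of α * of β = of (α ∪ β) := if_pos h

theorem of_mul_of_eq_absorbing {α β : Finset ℕ} (h : ¬ BlockLT α β) :
    of α * of β = absorbing := if_neg h

theorem blockLT_union_left {α β γ : Finset ℕ} :
    BlockLT (α ∪ β) γ ↔ BlockLT α γ ∧ BlockLT β γ := by
  simp only [BlockLT, Finset.mem_union]
  grind

theorem blockLT_union_right {α β γ : Finset ℕ} :
    BlockLT α (β ∪ γ) ↔ BlockLT α β ∧ BlockLT α γ := by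
  simp only [BlockLT, Finset.mem_union]
  grind

protected theorem mul_assoc (x y z : BlockSemigroup) : x * y * z = x * (y * z) := by
  rcases x with _ | α
  · rfl
  rcases y with _ | β
  · rfl
  rcases z with _ | γ
  · exact (mul_absorbing _).trans ((congrArg _ (mul_absorbing _)).trans (mul_absorbing _)).symm
  change of α * of β * of γ = of α * (of β * of γ)
  by_cases h1 : BlockLT α β <;> by_cases h2 : BlockLT β γ
  · rw [of_mul_of h1, of_mul_of h2]
    by_cases h3 : BlockLT α γ
    · rw [of_mul_of (blockLT_union_left.2 ⟨h3, h2⟩), of_mul_of (blockLT_union_right.2 ⟨h1, h3⟩),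
        Finset.union_assoc]
    · rw [of_mul_of_eq_absorbing fun h => h3 (blockLT_union_left.1 h).1,
        of_mul_of_eq_absorbing fun h => h3 (blockLT_union_right.1 h).2]
  · rw [of_mul_of h1, of_mul_of_eq_absorbing h2,
      of_mul_of_eq_absorbing fun h => h2 (blockLT_union_left.1 h).2]
    rfl
  · rw [of_mul_of h2, of_mul_of_eq_absorbing h1,
      of_mul_of_eq_absorbing fun h => h1 (blockLT_union_right.1 h).1]
    rfl
  · rw [of_mul_of_eq_absorbing h1, of_mul_of_eq_absorbing h2]
    rfl

noncomputable instance : Semigroup BlockSemigroup where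
  mul_assoc := BlockSemigroup.mul_assoc

/-- The value `n_α` at a block `α`, with the junk value `0` at the absorbing element. -/
def value (n : ℕ → ℤ) : BlockSemigroup → ℤ
  | some α => ipSum n α
  | none => 0

theorem value_mul (n : ℕ → ℤ) {x y : BlockSemigroup}
    (h : x * y ≠ absorbing) : value n (x * y) = value n x + value n y := by
  rcases x with _ | α
  · exact absurd rfl h
  rcases y with _ | β
  · exact absurd (mul_absorbing _) h
  change of α * of β ≠ _ at h
  change value n (of α * of β) = ipSum n α + ipSum n β
  by_cases hlt : BlockLT α β
  · rw [of_mul_of hlt]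
    exact Finset.sum_union (Finset.disjoint_left.2 fun i hi hj => lt_irrefl i (hlt i hi i hj))
  · exact absurd (of_mul_of_eq_absorbing hlt) h

end BlockSemigroup

open BlockSemigroup

theorem blockLT_of_lt {a : ℕ → Finset ℕ} (hne : ∀ i, (a i).Nonempty)
    (hlt : ∀ i, BlockLT (a i) (a (i + 1))) {i j : ℕ} (hij : i < j) : BlockLT (a i) (a j) := by
  induction j, hij using Nat.le_induction with
  | base => exact hlt i
  | succ j _ ih =>
    intro x hx y hy
    obtain ⟨z, hz⟩ := hne j
    exact (ih x hx z hz).trans (hlt j z hz y hy)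

/-- The finite products of a sequence of consecutive blocks belong to the IP-ring it generates. -/
theorem exists_biUnion_of_mem_FP {x : BlockSemigroup} {s : Stream' BlockSemigroup}
    (hx : x ∈ FP s) : ∀ a : ℕ → Finset ℕ, (∀ i, (a i).Nonempty) →
      (∀ i, BlockLT (a i) (a (i + 1))) → (∀ i, s.get i = of (a i)) →
      ∃ β : Finset ℕ, β.Nonempty ∧ x = of (β.biUnion a) := by
  induction hx with
  | head' s =>
    intro a _ _ hs
    exact ⟨{0}, by simp, by simpa using hs 0⟩
  | tail' s m _ ih =>
    intro a hne hlt hs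
    obtain ⟨β, hβ, rfl⟩ := ih (fun i => a (i + 1)) (fun i => hne _) (fun i => hlt _)
      (fun i => hs (i + 1))
    exact ⟨β.image (· + 1), hβ.image _, by rw [Finset.image_biUnion]⟩
  | cons' s m _ ih =>
    intro a hne hlt hs
    obtain ⟨β, hβ, rfl⟩ := ih (fun i => a (i + 1)) (fun i => hne _) (fun i => hlt _)
      (fun i => hs (i + 1))
    refine ⟨insert 0 (β.image (· + 1)), by simp, ?_⟩
    have h0 : s.head = of (a 0) := hs 0
    rw [h0, of_mul_of, Finset.biUnion_insert, Finset.image_biUnion]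
    intro x hx y hy
    obtain ⟨i, -, hi⟩ := Finset.mem_biUnion.1 hy
    exact blockLT_of_lt hne hlt (Nat.succ_pos i) x hx y hi

/-- A sequence in `BlockSemigroup` all of whose finite products are non-empty blocks generates an
IP-ring, which consists of these finite products. -/
theorem exists_isIPRing_of_FP {s : Stream' BlockSemigroup}
    (hs : ∀ x ∈ FP s, ∃ α : Finset ℕ, α.Nonempty ∧ x = of α) :
    ∃ R, IsIPRing R ∧ ∀ α ∈ R, of α ∈ FP s := by
  have hget : ∀ i, s.get i ∈ FP s := fun i =>
    FP_drop_subset_FP s i (by simpa using FP.head (s.drop i))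
  choose b hbne hb using fun i => hs _ (hget i)
  have hprod : ∀ F : Finset ℕ, F.Nonempty → ∀ k, (∀ x ∈ F, k ≤ x) →
      of (F.biUnion b) ∈ FP (s.drop k) := by
    intro F
    induction F using Finset.induction_on_min with
    | empty => exact fun h => absurd h (by simp)
    | insert c F hF ih =>
      intro _ k hk
      have hck : k ≤ c := hk c (by simp)
      have hmono : FP (s.drop c) ⊆ FP (s.drop k) := by
        have := FP_drop_subset_FP (s.drop k) (c - k)
        rwa [Stream'.drop_drop, Nat.add_sub_cancel' hck] at this
      apply hmono
      have hhead : (s.drop c).head = of (b c) := by rw [← hb c]; simp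
      rcases F.eq_empty_or_nonempty with rfl | hFne
      · have := FP.head (s.drop c)
        rw [hhead] at this
        simpa using this
      · have h1 := ih hFne (c + 1) hF
        have h2 := FP.cons (s.drop c) _ (by rwa [← Stream'.drop_drop, ← Stream'.tail_eq_drop] at h1)
        rw [hhead] at h2
        obtain ⟨γ, -, hγ⟩ := hs _ (FP_drop_subset_FP s c h2)
        rw [Finset.biUnion_insert]
        rwa [of_mul_of] at h2
        by_contra hlt
        rw [of_mul_of_eq_absorbing hlt] at hγ
        exact of_ne_absorbing γ hγ.symm
  refine ⟨_, ⟨b, hbne, fun i => ?_, rfl⟩, ?_⟩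
  · have h1 := FP.cons (s.drop i) (s.get (i + 1)) (by
      rw [Stream'.tail_eq_drop, Stream'.drop_drop, ← Stream'.head_drop]
      exact FP.head (s.drop (i + 1)))
    obtain ⟨γ, -, hγ⟩ := hs _ (FP_drop_subset_FP s i h1)
    have hhead : (s.drop i).head = of (b i) := by rw [← hb i]; simp
    rw [hhead, hb (i + 1)] at hγ
    by_contra hlt
    rw [of_mul_of_eq_absorbing hlt] at hγ
    exact of_ne_absorbing γ hγ.symm
  · rintro α ⟨β, hβ, rfl⟩
    simpa using hprod β hβ 0 (fun x _ => Nat.zero_le x)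

attribute [local instance] Ultrafilter.mul Ultrafilter.semigroup in
/-- Every IP-ring carries an idempotent ultrafilter of integers `n_α` that contains the whole dual
family `𝒢_A^*`: the complement of a set it misses contains, by idempotence, all `n_α` with `α` in
some IP-ring. -/
theorem exists_idempotent_ultrafilter (n : ℕ → ℤ) {R : Set (Finset ℕ)} (hR : IsIPRing R) :
    ∃ p : Ultrafilter ℤ,
      (∀ C : Set ℤ, (∀ᶠ m in p, m ∈ C) → ∀ᶠ k in p, ∀ᶠ m in p, k + m ∈ C) ∧
      (∀ᶠ m in p, m ∈ ipSum n '' R) ∧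
      ∀ D ∈ dualFamily (ipFamily n), ∀ᶠ m in p, m ∈ D := by
  obtain ⟨a, hne, hlt, rfl⟩ := hR
  obtain ⟨q, hq, hqa⟩ := exists_idempotent_ultrafilter_le_FP
    (fun i => of (a i) : Stream' BlockSemigroup)
  have hqR : ∀ᶠ x in (q : Filter BlockSemigroup),
      ∃ β : Finset ℕ, β.Nonempty ∧ x = of (β.biUnion a) :=
    hqa.mono fun x hx => exists_biUnion_of_mem_FP hx a hne hlt fun i => rfl
  refine ⟨q.map (value n), fun C hC => ?_, ?_, fun D hD => ?_⟩
  · have hC' : ∀ᶠ x in (q : Filter BlockSemigroup), value n x ∈ C := hC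
    have h := hC'.and hqR
    rw [← hq, Ultrafilter.eventually_mul] at h
    change ∀ᶠ x in (q : Filter BlockSemigroup), ∀ᶠ y in (q : Filter BlockSemigroup),
      value n x + value n y ∈ C
    refine h.mono fun x hx => hx.mono ?_
    rintro y ⟨hy, β, -, hβ⟩
    rwa [← value_mul n (by rw [hβ]; exact of_ne_absorbing _)]
  · change ∀ᶠ x in (q : Filter BlockSemigroup), value n x ∈ _
    refine hqR.mono ?_
    rintro x ⟨β, hβ, rfl⟩
    exact ⟨_, ⟨β, hβ, rfl⟩, rfl⟩
  · by_contra hnot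
    rw [← Ultrafilter.eventually_not] at hnot
    have hnot' : ∀ᶠ x in (q : Filter BlockSemigroup), value n x ∉ D := hnot
    obtain ⟨s, hs⟩ := exists_FP_of_large q hq _ (hnot'.and hqR)
    obtain ⟨R, hR, hRs⟩ := exists_isIPRing_of_FP (s := s) fun x hx => by
      obtain ⟨-, β, ⟨i, hi⟩, rfl⟩ := hs hx
      exact ⟨_, (hne i).mono (Finset.subset_biUnion_of_mem a hi), rfl⟩
    obtain ⟨m, hmD, α, hα, rfl⟩ := hD _ ⟨R, hR, subset_rfl⟩
    exact (hs (hRs α hα)).1 hmD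

/-! ### Polynomial maps into an abelian group -/

section PolyMaps

/-- The translate `m ↦ g (m + k)` of a map defined on the integers. -/
def shift {Γ : Type*} (k : ℤ) (g : ℤ → Γ) : ℤ → Γ := fun m => g (m + k)

variable {Γ : Type*}

@[simp] theorem shift_apply (k : ℤ) (g : ℤ → Γ) (m : ℤ) : shift k g m = g (m + k) := rfl

theorem shift_shift (k l : ℤ) (g : ℤ → Γ) : shift k (shift l g) = shift (k + l) g := by
  funext m
  simp [add_assoc]

theorem shift_zero (g : ℤ → Γ) : shift 0 g = g := by
  funext m
  simp

variable [CommGroup Γ]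

@[simp] theorem shift_one (k : ℤ) : shift k (1 : ℤ → Γ) = 1 := rfl

theorem shift_mul (k : ℤ) (f g : ℤ → Γ) : shift k (f * g) = shift k f * shift k g := rfl

theorem shift_inv (k : ℤ) (g : ℤ → Γ) : shift k g⁻¹ = (shift k g)⁻¹ := rfl

theorem shift_div (k : ℤ) (f g : ℤ → Γ) : shift k (f / g) = shift k f / shift k g := rfl

theorem shift_zpow (k : ℤ) (g : ℤ → Γ) (h : ℤ) : shift k (g ^ h) = shift k g ^ h := rfl

variable (Γ) in
/-- The group of polynomial maps `ℤ → Γ` of degree at most `e`: those for which all iterated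
differences of order `e` are constant. -/
def polyMaps : ℕ → Subgroup (ℤ → Γ)
  | 0 =>
    { carrier := {g | ∀ m m', g m = g m'}
      mul_mem' := fun hf hg m m' => congrArg₂ (· * ·) (hf m m') (hg m m')
      one_mem' := fun _ _ => rfl
      inv_mem' := fun hg m m' => congrArg (·⁻¹) (hg m m') }
  | e + 1 =>
    { carrier := {g | ∀ k, shift k g / g ∈ polyMaps e}
      mul_mem' := fun {f g} hf hg k => by
        rw [shift_mul, mul_div_mul_comm]
        exact mul_mem (hf k) (hg k)
      one_mem' := fun k => by
        rw [shift_one, div_one]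
        exact one_mem _
      inv_mem' := fun {g} hg k => by
        have : shift k g⁻¹ / g⁻¹ = (shift k g / g)⁻¹ := by
          rw [shift_inv, inv_div_inv, inv_div]
        rw [this]
        exact inv_mem (hg k) }

theorem mem_polyMaps_zero {g : ℤ → Γ} : g ∈ polyMaps Γ 0 ↔ ∀ m m', g m = g m' := Iff.rfl

theorem dependsNontrivially_iff {g : ℤ → Γ} : DependsNontrivially g ↔ g ∉ polyMaps Γ 0 := by
  simp [mem_polyMaps_zero, DependsNontrivially]

theorem polyMaps_le_succ (e : ℕ) : polyMaps Γ e ≤ polyMaps Γ (e + 1) := by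
  induction e with
  | zero =>
    intro g hg k
    have : shift k g / g = 1 := by
      funext m
      simp [mem_polyMaps_zero.1 hg (m + k) m]
    rw [this]
    exact one_mem _
  | succ e ih => exact fun g hg k => ih (hg k)

theorem polyMaps_mono : Monotone (polyMaps Γ) := monotone_nat_of_le_succ polyMaps_le_succ

theorem shift_div_mem {g : ℤ → Γ} {e : ℕ} (hg : g ∈ polyMaps Γ (e + 1)) (k l : ℤ) :
    shift k g / shift l g ∈ polyMaps Γ e := by
  have := div_mem (hg k) (hg l)
  rwa [div_div_div_cancel_right] at this

theorem shift_mem {g : ℤ → Γ} {e : ℕ} (hg : g ∈ polyMaps Γ e) (k : ℤ) :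
    shift k g ∈ polyMaps Γ e := by
  have := mul_mem (polyMaps_le_succ e hg k) hg
  rwa [div_mul_cancel] at this

theorem shift_mem_iff {g : ℤ → Γ} {e : ℕ} (k : ℤ) :
    shift k g ∈ polyMaps Γ e ↔ g ∈ polyMaps Γ e := by
  refine ⟨fun h => ?_, fun h => shift_mem h k⟩
  simpa [shift_shift, shift_zero] using shift_mem h (-k)

theorem mem_polyMaps_of_zpow_mem [IsMulTorsionFree Γ] {h : ℤ} (hh : h ≠ 0) {e : ℕ} {g : ℤ → Γ}
    (hg : g ^ h ∈ polyMaps Γ e) : g ∈ polyMaps Γ e := by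
  induction e generalizing g with
  | zero => exact fun m m' => zpow_left_injective hh (hg m m')
  | succ e ih =>
    intro k
    apply ih
    rw [div_zpow, ← shift_zpow]
    exact hg k

/-- A polynomial map with values in a torsion-free group is affine as soon as one of its non-trivial
differences is constant. -/
theorem mem_polyMaps_one_of_shift_div_mem [IsMulTorsionFree Γ] {h : ℤ} (hh : h ≠ 0) {D : ℕ}
    {g : ℤ → Γ} (hg : g ∈ polyMaps Γ D) (hgh : shift h g / g ∈ polyMaps Γ 0) :
    g ∈ polyMaps Γ 1 := by
  induction D with
  | zero => exact polyMaps_le_succ 0 hg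
  | succ D ih =>
    rcases D with _ | e
    · exact hg
    refine ih fun l => mem_polyMaps_of_zpow_mem hh ?_
    -- Modulo maps of degree `≤ e`, the difference `shift k g / g` is additive in `k`.
    let φ : Multiplicative ℤ →* (ℤ → Γ) ⧸ polyMaps Γ e :=
      MonoidHom.mk' (fun k => QuotientGroup.mk (shift k.toAdd g / g)) fun k l => by
        rw [← QuotientGroup.mk_mul, QuotientGroup.eq_iff_div_mem]
        have := shift_div_mem (hg k.toAdd) l.toAdd 0
        rw [shift_zero] at this
        convert this using 1
        rw [shift_div, shift_shift, toAdd_mul, add_comm k.toAdd,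
          ← div_mul_div_cancel _ (shift l.toAdd g) g, mul_div_mul_right_eq_div]
    have hφ : ∀ k, φ (Multiplicative.ofAdd k) = 1 ↔ shift k g / g ∈ polyMaps Γ e := fun k =>
      QuotientGroup.eq_one_iff _
    have h1 : φ (Multiplicative.ofAdd l) ^ h = 1 := by
      rw [← map_zpow, ← ofAdd_zsmul, smul_eq_mul, mul_comm, ← smul_eq_mul, ofAdd_zsmul, map_zpow,
        (hφ h).2 (polyMaps_mono (Nat.zero_le e) hgh), one_zpow]
    exact (QuotientGroup.eq_one_iff ((shift l g / g) ^ h)).1 h1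

/-- An affine map is `m ↦ c * S ^ m`. -/
theorem apply_add_of_mem_polyMaps_one {g : ℤ → Γ} (hg : g ∈ polyMaps Γ 1) (m k : ℤ) :
    g (m + k) = (g 1 / g 0) ^ k * g m := by
  have h1 : ∀ m, g (m + 1) = (g 1 / g 0) * g m := fun m => by
    have := mem_polyMaps_zero.1 (hg 1) m 0
    simp only [Pi.div_apply, shift_apply, zero_add] at this
    rw [← this, div_mul_cancel]
  induction k using Int.induction_on with
  | zero => simp
  | succ k ih => rw [← add_assoc, h1, ih, zpow_add_one, ← mul_assoc, mul_comm (g 1 / g 0)]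
  | pred k ih =>
    have h2 := h1 (m + (-k - 1))
    rw [show m + (-(k : ℤ) - 1) + 1 = m + -k by ring, ih] at h2
    rw [zpow_sub_one, mul_right_comm, h2, mul_comm, inv_mul_cancel_left]

theorem zpow_mem_polyMaps (T : Γ) {f : ℤ → ℤ} {q : Polynomial ℚ}
    (hq : ∀ m : ℤ, q.eval (m : ℚ) = (f m : ℚ)) {e : ℕ} (he : q.natDegree ≤ e) :
    (fun m => T ^ f m) ∈ polyMaps Γ e := by
  induction e generalizing f q with
  | zero =>
    rw [Polynomial.eq_C_of_natDegree_le_zero he] at hq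
    intro m m'
    have : f m = f m' := by
      have := (hq m).symm.trans ((by simp : _ = _).trans (hq m'))
      exact_mod_cast this
    simp only [this]
  | succ e ih =>
    intro k
    have : shift k (fun m => T ^ f m) / (fun m => T ^ f m) = fun m => T ^ (f (m + k) - f m) := by
      funext m
      simp [zpow_sub, div_eq_mul_inv]
    rw [this]
    refine ih (q := Polynomial.taylor (k : ℚ) q - q) (fun m => ?_) ?_
    · rw [Polynomial.eval_sub, Polynomial.taylor_eval, hq]
      have := hq (m + k)
      push_cast at this ⊢
      rw [this]
    · by_cases h0 : Polynomial.taylor (k : ℚ) q - q = 0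
      · simp [h0]
      · have hq0 : q ≠ 0 := by
          rintro rfl
          simp at h0
        have := Polynomial.natDegree_lt_natDegree h0 (Polynomial.degree_sub_lt_right
          (Polynomial.degree_taylor q (k : ℚ)) hq0 (Polynomial.leadingCoeff_taylor (k : ℚ) q))
        omega

theorem exists_gammaPoly_mem_polyMaps {d : ℕ} (T : Fin d → Γ) {p : Fin d → ℤ → ℤ}
    (hp : ∀ j, IsIntegralPolynomial (p j)) : ∃ D, gammaPoly T p ∈ polyMaps Γ D := by
  choose q hq using hp
  refine ⟨Finset.univ.sup fun j => (q j).natDegree, ?_⟩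
  have : gammaPoly T p = ∏ j, fun m => T j ^ p j m := by
    funext m
    simp [gammaPoly]
  rw [this]
  exact prod_mem fun j _ => zpow_mem_polyMaps (T j) (hq j) 
    (Finset.le_sup (f := fun j => (q j).natDegree) (Finset.mem_univ j))

end PolyMaps

/-! ### Weights of families of polynomial maps -/

section Weight

variable {Γ ι ι' : Type*} [CommGroup Γ]

/-- The leading terms of degree `e + 1` of a family of polynomial maps: the classes, modulo maps of
degree at most `e`, of its members of degree exactly `e + 1`. -/
def leadingClasses (g : ι → ℤ → Γ) (e : ℕ) : Set ((ℤ → Γ) ⧸ polyMaps Γ e) :=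
  {q | ∃ i, g i ∈ polyMaps Γ (e + 1) ∧ g i ∉ polyMaps Γ e ∧ QuotientGroup.mk (g i) = q}

theorem finite_leadingClasses [Finite ι] (g : ι → ℤ → Γ) (e : ℕ) : (leadingClasses g e).Finite :=
  (Set.finite_range fun i => (QuotientGroup.mk (g i) : (ℤ → Γ) ⧸ polyMaps Γ e)).subset
    fun _ ⟨i, _, _, h⟩ => ⟨i, h⟩

/-- The weight of a family of polynomial maps of degree at most `D`: the numbers of its leading
terms in the degrees `1, …, D`, compared at the largest degree where they differ. -/
noncomputable def weight (D : ℕ) (g : ι → ℤ → Γ) : Colex (Fin D → ℕ) :=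
  toColex fun e => (leadingClasses g e).ncard

theorem toColex_lt_of_le_above {D : ℕ} {a b : Fin D → ℕ} (d : Fin D) (hd : a d < b d)
    (hle : ∀ e, d < e → a e ≤ b e) : toColex a < toColex b := by
  have hne : (Finset.univ.filter fun e => a e < b e).Nonempty := ⟨d, by simpa using hd⟩
  refine ⟨Finset.max' _ hne, fun e he => ?_, (Finset.mem_filter.1 (Finset.max'_mem _ hne)).2⟩
  have hde : d < e := (Finset.le_max' _ d (by simpa using hd)).trans_lt he
  refine (hle e hde).antisymm (not_lt.1 fun hlt => ?_)
  exact (Finset.le_max' _ e (by simpa using hlt)).not_gt he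

/-- Dividing translates of the members of a family by a translate of a member of minimal degree
lowers the weight: the leading terms of higher degree stay the same, and in the minimal degree they
are divided by that of the chosen member, which disappears. -/
theorem weight_lt [Finite ι] {D d : ℕ} (hd : d < D) {g : ι → ℤ → Γ} {g' : ι' → ℤ → Γ}
    {i₁ : ι} (hi₁ : g i₁ ∈ polyMaps Γ (d + 1)) (hmin : ∀ i, g i ∉ polyMaps Γ d) (k₁ : ℤ)
    (i : ι' → ι) (k : ι' → ℤ) (hg' : ∀ x, g' x = shift (k x) (g (i x)) / shift k₁ (g i₁)) :
    weight D g' < weight D g := by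
  have hmem : ∀ x e, d + 1 ≤ e → (g' x ∈ polyMaps Γ e ↔ g (i x) ∈ polyMaps Γ e) := by
    intro x e he
    rw [hg', div_mem_comm_iff, div_eq_mul_inv,
      Subgroup.mul_mem_cancel_left _ (shift_mem (polyMaps_mono he hi₁) k₁), inv_mem_iff,
      shift_mem_iff]
  have hmk : ∀ x e, g (i x) ∈ polyMaps Γ (e + 1) →
      (QuotientGroup.mk (shift (k x) (g (i x))) : (ℤ → Γ) ⧸ polyMaps Γ e) =
        QuotientGroup.mk (g (i x)) := by
    intro x e h
    rw [QuotientGroup.eq_iff_div_mem]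
    exact h (k x)
  refine toColex_lt_of_le_above ⟨d, hd⟩ ?_ fun e he => ?_
  · change (leadingClasses g' d).ncard < (leadingClasses g d).ncard
    set q₁ : (ℤ → Γ) ⧸ polyMaps Γ d := QuotientGroup.mk (g i₁) with hq₁
    have hsub : leadingClasses g' d ⊆ (fun q => q / q₁) '' (leadingClasses g d \ {q₁}) := by
      rintro _ ⟨x, hx1, hx2, rfl⟩
      have hx := (hmem x (d + 1) le_rfl).1 hx1
      have hq : (QuotientGroup.mk (g' x) : (ℤ → Γ) ⧸ polyMaps Γ d) =
          QuotientGroup.mk (g (i x)) / q₁ := by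
        rw [hg', QuotientGroup.mk_div, hmk x d hx, hq₁]
        congr 1
        rw [QuotientGroup.eq_iff_div_mem]
        exact hi₁ k₁
      refine ⟨_, ⟨⟨i x, hx, hmin _, rfl⟩, fun h => hx2 ?_⟩, hq.symm⟩
      rw [← QuotientGroup.eq_one_iff, hq, div_eq_one]
      exact h
    have hfin := finite_leadingClasses g d
    calc (leadingClasses g' d).ncard
        ≤ ((fun q => q / q₁) '' (leadingClasses g d \ {q₁})).ncard :=
          Set.ncard_le_ncard hsub (hfin.sdiff.image _)
      _ ≤ (leadingClasses g d \ {q₁}).ncard := Set.ncard_image_le hfin.sdiff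
      _ < (leadingClasses g d).ncard :=
          Set.ncard_sdiff_singleton_lt_of_mem ⟨i₁, hi₁, hmin _, rfl⟩ hfin
  · have hde : d + 1 ≤ (e : ℕ) := he
    change (leadingClasses g' e).ncard ≤ (leadingClasses g e).ncard
    refine Set.ncard_le_ncard ?_ (finite_leadingClasses g e)
    rintro _ ⟨x, hx1, hx2, rfl⟩
    have hx := (hmem x (e + 1) (by omega)).1 hx1
    refine ⟨i x, hx, fun h => hx2 ((hmem x e hde).2 h), ?_⟩
    rw [hg', QuotientGroup.mk_div, hmk x e hx,
      (QuotientGroup.eq_one_iff (shift k₁ (g i₁))).2 (shift_mem (polyMaps_mono hde hi₁) k₁), div_one]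

end Weight

/-! ### Mixing along an idempotent ultrafilter -/

/-- The ultrafilter `p` on `ℤ` is idempotent, and every non-trivial element of `Γ` acts on `X` as a
`p`-mixing transformation. -/
structure IsMixingUltrafilter (Γ X : Type*) [CommGroup Γ] [TopologicalSpace X] [MulAction Γ X]
    (p : Ultrafilter ℤ) : Prop where
  idem : ∀ C : Set ℤ, (∀ᶠ m in p, m ∈ C) → ∀ᶠ k in p, ∀ᶠ m in p, k + m ∈ C
  mixing : ∀ T : Γ, T ≠ 1 → ∀ U V : Set X, IsOpen U → U.Nonempty → IsOpen V → V.Nonempty →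
    ∀ᶠ m : ℤ in p, ∃ x ∈ U, T ^ m • x ∈ V

section

variable {Γ : Type*} [CommGroup Γ] {X : Type*} [TopologicalSpace X] [MulAction Γ X]
  {p : Ultrafilter ℤ}

theorem IsMixingUltrafilter.not_eventually_zpow_eq_one [T2Space X] [Nontrivial X]
    (hp : IsMixingUltrafilter Γ X p) {T : Γ} (hT : T ≠ 1) : ¬ ∀ᶠ m : ℤ in p, T ^ m = 1 := by
  intro h
  obtain ⟨x, y, hxy⟩ := exists_pair_ne X
  obtain ⟨U, V, hU, hV, hx, hy, hUV⟩ := t2_separation hxy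
  obtain ⟨m, ⟨z, hzU, hzV⟩, hm⟩ := ((hp.mixing T hT U V hU ⟨x, hx⟩ hV ⟨y, hy⟩).and h).exists
  rw [hm, one_smul] at hzV
  exact Set.disjoint_left.1 hUV hzU hzV

theorem IsMixingUltrafilter.le_cofinite [T2Space X] [Nontrivial X] [Nontrivial Γ]
    (hp : IsMixingUltrafilter Γ X p) : (p : Filter ℤ) ≤ cofinite := by
  rcases p.le_cofinite_or_eq_pure with h | ⟨c, rfl⟩
  · exact h
  obtain ⟨T, hT⟩ := exists_ne (1 : Γ)
  have hc : c + c = c := hp.idem {c} rfl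
  refine absurd ?_ (hp.not_eventually_zpow_eq_one hT)
  change T ^ c = 1
  rw [show c = 0 by omega, zpow_zero]

/-- An element of finite order `h` acts trivially along `p`, since an idempotent ultrafilter contains
the multiples of `h`. -/
theorem IsMixingUltrafilter.isMulTorsionFree [T2Space X] [Nontrivial X]
    (hp : IsMixingUltrafilter Γ X p) : IsMulTorsionFree Γ := by
  refine ⟨fun h hh a b hab => ?_⟩
  have hT : (a / b) ^ h = 1 := by
    rw [div_pow, div_eq_one]
    exact hab
  by_contra hne
  have : NeZero h := ⟨hh⟩
  refine hp.not_eventually_zpow_eq_one (T := a / b) (fun h1 => hne (div_eq_one.1 h1)) ?_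
  obtain ⟨r, hr⟩ := (p.map (fun m : ℤ => (m : ZMod h))).eq_pure_of_finite
  have hpr : ∀ᶠ m : ℤ in p, (m : ZMod h) = r := by
    have : ∀ᶠ x in (p.map (fun m : ℤ => (m : ZMod h)) : Filter (ZMod h)), x = r := by
      rw [hr]
      rfl
    exact this
  obtain ⟨k, hk, hk'⟩ := (hpr.and (hp.idem {m | (m : ZMod h) = r} hpr)).exists
  obtain ⟨m, hm, hm'⟩ := (hpr.and hk').exists
  have hr0 : r = 0 := by
    have : ((k + m : ℤ) : ZMod h) = r := hm'
    rw [Int.cast_add, hk, hm] at this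
    simpa using this
  refine hpr.mono fun m hm => ?_
  obtain ⟨c, rfl⟩ := (ZMod.intCast_zmod_eq_zero_iff_dvd m h).1 (hm.trans hr0)
  rw [zpow_mul, zpow_natCast, hT, one_zpow]

/-- For a polynomial map that is not affine, only one translate agrees up to a constant with a given
map. -/
theorem subsingleton_shift_div_mem [IsMulTorsionFree Γ] {D : ℕ} {g : ℤ → Γ}
    (hg : g ∈ polyMaps Γ D) (hg1 : g ∉ polyMaps Γ 1) (f : ℤ → Γ) :
    {k | shift k g / f ∈ polyMaps Γ 0}.Subsingleton := by
  intro k hk l hl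
  by_contra hkl
  refine hg1 (mem_polyMaps_one_of_shift_div_mem (h := k - l) (sub_ne_zero.2 hkl) hg ?_)
  have : _ ∈ polyMaps Γ 0 := div_mem (H := polyMaps Γ 0) hk hl
  rw [div_div_div_cancel_right] at this
  rwa [← shift_mem_iff l, shift_div, shift_shift, add_sub_cancel]

variable [ContinuousConstSMul Γ X]

/-- Parameters `k s`, one for each `s ∈ J`, such that the translates of the non-affine members of a
family by different parameters differ by more than a constant, while for the affine members the
translations are absorbed by shrinking the target sets. -/
theorem IsMixingUltrafilter.exists_shifts [T2Space X] [Nontrivial X] [Nontrivial Γ]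
    (hp : IsMixingUltrafilter Γ X p) {ι : Type*} [Finite ι] {D : ℕ} {g : ι → ℤ → Γ}
    (hD : ∀ i, g i ∈ polyMaps Γ D) (hconst : ∀ i, g i ∉ polyMaps Γ 0)
    {V : ι → Set X} (hV : ∀ i, IsOpen (V i)) (hVne : ∀ i, (V i).Nonempty)
    {E : Set ℤ} (hE : ∀ᶠ k in p, k ∈ E) (J : Finset Γ) :
    ∃ (k : Γ → ℤ) (W : ι → Set X), (∀ s ∈ J, k s ∈ E) ∧
      (∀ s ∈ J, ∀ t ∈ J, s ≠ t → ∀ i j, g i ∉ polyMaps Γ 1 → g j ∉ polyMaps Γ 1 →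
        shift (k s) (g i) / shift (k t) (g j) ∉ polyMaps Γ 0) ∧
      ∀ i, IsOpen (W i) ∧ (W i).Nonempty ∧
        (g i ∈ polyMaps Γ 1 → ∀ s ∈ J, ∀ x ∈ W i, s • (g i 1 / g i 0) ^ k s • x ∈ V i) := by
  classical
  have := hp.isMulTorsionFree
  induction J using Finset.induction_on with
  | empty => exact ⟨0, V, by simp, by simp, fun i => ⟨hV i, hVne i, by simp⟩⟩
  | insert s J hs ih =>
    obtain ⟨k, W, hkE, hkg, hW⟩ := ih
    have h1 : ∀ᶠ l in (p : Filter ℤ), ∀ t ∈ J, ∀ i j, g i ∉ polyMaps Γ 1 → g j ∉ polyMaps Γ 1 →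
        shift l (g i) / shift (k t) (g j) ∉ polyMaps Γ 0 := by
      rw [eventually_all_finset]
      refine fun t _ => eventually_all.2 fun i => eventually_all.2 fun j => ?_
      by_cases hi : g i ∈ polyMaps Γ 1
      · exact .of_forall fun _ h => absurd hi h
      · have hfin := (subsingleton_shift_div_mem (hD i) hi (shift (k t) (g j))).finite
        filter_upwards [hp.le_cofinite hfin.compl_mem_cofinite] with l hl _ _ using hl
    have h2 : ∀ᶠ l in (p : Filter ℤ), ∀ i, g i ∈ polyMaps Γ 1 →
        ∃ x ∈ W i, (g i 1 / g i 0) ^ l • x ∈ (fun x => s • x) ⁻¹' V i := by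
      refine eventually_all.2 fun i => ?_
      by_cases hi : g i ∈ polyMaps Γ 1
      · have hS : g i 1 / g i 0 ≠ 1 := fun h => hconst i fun m m' => by
          rw [← zero_add m, ← zero_add m', apply_add_of_mem_polyMaps_one hi,
            apply_add_of_mem_polyMaps_one hi 0 m', h, one_zpow, one_zpow]
        refine (hp.mixing _ hS (W i) _ (hW i).1 (hW i).2.1 ((hV i).preimage (continuous_const_smul s))
          ?_).mono fun l hl _ => hl
        obtain ⟨v, hv⟩ := hVne i
        exact ⟨s⁻¹ • v, by simpa using hv⟩
      · exact .of_forall fun _ h => absurd h hi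
    obtain ⟨l, hlE, hl1, hl2⟩ := (hE.and (h1.and h2)).exists
    refine ⟨Function.update k s l,
      fun i => if g i ∈ polyMaps Γ 1 then
        W i ∩ {x | s • (g i 1 / g i 0) ^ l • x ∈ V i} else W i, ?_, ?_, fun i => ?_⟩
    · intro t ht
      rcases Finset.mem_insert.1 ht with rfl | ht
      · simpa using hlE
      · rw [Function.update_of_ne (ne_of_mem_of_not_mem ht hs)]
        exact hkE t ht
    · intro t ht u hu htu i j hi hj
      rcases Finset.mem_insert.1 ht with rfl | ht' <;> rcases Finset.mem_insert.1 hu with rfl | hu'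
      · exact absurd rfl htu
      · rw [Function.update_self, Function.update_of_ne htu.symm]
        exact hl1 u hu' i j hi hj
      · rw [Function.update_self, Function.update_of_ne htu]
        intro h
        apply hl1 t ht' j i hj hi
        rw [← inv_div]
        exact inv_mem h
      · rw [Function.update_of_ne (ne_of_mem_of_not_mem ht' hs),
          Function.update_of_ne (ne_of_mem_of_not_mem hu' hs)]
        exact hkg t ht' u hu' htu i j hi hj
    · by_cases hi : g i ∈ polyMaps Γ 1
      · simp only [if_pos hi]
        refine ⟨(hW i).1.inter ((hV i).preimage
          ((continuous_const_smul s).comp (continuous_const_smul _))), hl2 i hi, fun _ t ht x hx => ?_⟩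
        rcases Finset.mem_insert.1 ht with rfl | ht
        · rw [Function.update_self]
          exact hx.2
        · rw [Function.update_of_ne (ne_of_mem_of_not_mem ht hs)]
          exact (hW i).2.2 hi t ht x hx.1
      · simp only [if_neg hi]
        exact ⟨(hW i).1, (hW i).2.1, fun h => absurd h hi⟩

end

/-! ### Joint mixing of families of polynomial maps -/

/-- Joint mixing along `p` of a finite family of non-constant polynomial maps with non-constant
ratios, by induction on the weight of the family. -/
theorem IsMixingUltrafilter.eventually_exists {Γ : Type u} [CommGroup Γ] {X : Type*}
    [TopologicalSpace X] [MulAction Γ X] {p : Ultrafilter ℤ} [ContinuousConstSMul Γ X]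
    [CompactSpace X] [T2Space X] [Nontrivial X] [Nontrivial Γ] [MulAction.IsMinimal Γ X]
    (hp : IsMixingUltrafilter Γ X p) {D : ℕ} {ι : Type u} [Finite ι] {g : ι → ℤ → Γ}
    (hD : ∀ i, g i ∈ polyMaps Γ D) (hconst : ∀ i, g i ∉ polyMaps Γ 0)
    (hratio : ∀ i j, i ≠ j → g i / g j ∉ polyMaps Γ 0)
    {U : Set X} (hU : IsOpen U) (hUne : U.Nonempty)
    {V : ι → Set X} (hV : ∀ i, IsOpen (V i)) (hVne : ∀ i, (V i).Nonempty) :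
    ∀ᶠ m in p, ∃ x ∈ U, ∀ i, g i m • x ∈ V i := by
  classical
  generalize hw : weight D g = w
  induction w using WellFoundedLT.induction generalizing ι U with
  | ind w ih =>
  subst hw
  rcases isEmpty_or_nonempty ι with hι | ⟨⟨i₀⟩⟩
  · obtain ⟨x, hx⟩ := hUne
    exact .of_forall fun m => ⟨x, hx, fun i => hι.elim i⟩
  -- A member `g i₁` of minimal degree `d + 1`.
  obtain ⟨d, hd, i₁, hi₁, hmin⟩ : ∃ d, d < D ∧ ∃ i₁, g i₁ ∈ polyMaps Γ (d + 1) ∧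
      ∀ i, g i ∉ polyMaps Γ d := by
    have hex : ∃ e, ∃ i, g i ∈ polyMaps Γ e := ⟨D, i₀, hD i₀⟩
    obtain ⟨i₁, hi₁⟩ := Nat.find_spec hex
    have hle := Nat.find_min' hex ⟨i₀, hD i₀⟩
    have hfind := fun e (he : e < Nat.find hex) => Nat.find_min hex he
    generalize Nat.find hex = e at *
    rcases e with _ | d
    · exact absurd hi₁ (hconst i₁)
    · exact ⟨d, hle, i₁, hi₁, fun i hi => hfind d d.lt_succ_self ⟨i, hi⟩⟩
  by_contra hnot
  rw [← Ultrafilter.eventually_not] at hnot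
  set B : Set ℤ := {m | ¬ ∃ x ∈ U, ∀ i, g i m • x ∈ V i} with hB
  obtain ⟨J, hJ⟩ : ∃ J : Finset Γ, ∀ y : X, ∃ s ∈ J, s • y ∈ U := by
    obtain ⟨I, hI⟩ := isCompact_univ.exists_finite_cover_smul Γ hU hUne
    refine ⟨I.image (·⁻¹), fun y => ?_⟩
    obtain ⟨s, hs, hy⟩ := Set.mem_iUnion₂.1 (hI (Set.mem_univ y))
    exact ⟨s⁻¹, Finset.mem_image_of_mem _ hs, Set.mem_smul_set_iff_inv_smul_mem.1 hy⟩
  obtain ⟨k, W, hkB, hkg, hW⟩ := hp.exists_shifts hD hconst hV hVne (hp.idem B hnot) J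
  -- The new family: all translates of the non-affine members, and the affine members themselves,
  -- since translating those only changes them by a constant.
  let Y : Type u := ({i // g i ∉ polyMaps Γ 1} × {s // s ∈ J}) ⊕ {i // g i ∈ polyMaps Γ 1}
  let idx : Y → ι := Sum.elim (fun y => y.1) (fun i => i)
  let κ : Y → ℤ := Sum.elim (fun y => k y.2) (fun _ => 0)
  let φ : Y → ℤ → Γ := fun y => shift (κ y) (g (idx y))
  let tgt : Y → Set X := Sum.elim (fun y => (fun x => (y.2 : Γ) • x) ⁻¹' V y.1) (fun i => W i)
  have hφD : ∀ y, φ y ∈ polyMaps Γ D := fun y => shift_mem (hD _) _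
  have htgt : ∀ y, IsOpen (tgt y) := by
    rintro (⟨i, s⟩ | i)
    · exact (hV i).preimage (continuous_const_smul (s : Γ))
    · exact (hW i).1
  have htgtne : ∀ y, (tgt y).Nonempty := by
    rintro (⟨i, s⟩ | i)
    · obtain ⟨v, hv⟩ := hVne i
      exact ⟨(s : Γ)⁻¹ • v, by simpa [tgt] using hv⟩
    · exact (hW i).2.1
  have hφ : ∀ y y', y ≠ y' → φ y / φ y' ∉ polyMaps Γ 0 := by
    rintro (⟨⟨i, hi⟩, ⟨s, hs⟩⟩ | ⟨i, hi⟩) (⟨⟨j, hj⟩, ⟨t, ht⟩⟩ | ⟨j, hj⟩) hne h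
    · change shift (k s) (g i) / shift (k t) (g j) ∈ _ at h
      by_cases hst : s = t
      · subst hst
        rw [← shift_div, shift_mem_iff] at h
        exact hratio i j (fun hij => hne (by subst hij; rfl)) h
      · exact hkg s hs t ht hst i j hi hj h
    · change shift (k s) (g i) / shift 0 (g j) ∈ _ at h
      rw [shift_zero] at h
      have := mul_mem (polyMaps_le_succ 0 h) hj
      rw [div_mul_cancel, shift_mem_iff] at this
      exact hi this
    · change shift 0 (g i) / shift (k t) (g j) ∈ _ at h
      rw [shift_zero, ← inv_mem_iff, inv_div] at h
      have := mul_mem (polyMaps_le_succ 0 h) hi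
      rw [div_mul_cancel, shift_mem_iff] at this
      exact hj this
    · change shift 0 (g i) / shift 0 (g j) ∈ _ at h
      rw [shift_zero, shift_zero] at h
      exact hratio i j (fun hij => hne (by subst hij; rfl)) h
  obtain ⟨y₁, hy₁⟩ : ∃ y₁, idx y₁ = i₁ := by
    by_cases hi : g i₁ ∈ polyMaps Γ 1
    · exact ⟨Sum.inr ⟨i₁, hi⟩, rfl⟩
    · obtain ⟨x, -⟩ := hUne
      obtain ⟨s, hs, -⟩ := hJ x
      exact ⟨Sum.inl ⟨⟨i₁, hi⟩, ⟨s, hs⟩⟩, rfl⟩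
  subst hy₁
  have key := ih _ (weight_lt (ι' := {y // y ≠ y₁}) (g' := fun y => φ y.1 / φ y₁) hd hi₁ hmin (κ y₁)
    (fun y => idx y.1) (fun y => κ y.1) fun _ => rfl) (fun y => div_mem (hφD _) (hφD _))
    (fun y => hφ _ _ y.2) (fun (y y' : {y // y ≠ y₁}) hyy' => by
      rw [div_div_div_cancel_right]
      exact hφ _ _ fun h => hyy' (Subtype.ext h)) (htgt y₁) (htgtne y₁)
    (V := fun y => tgt y.1) (fun y => htgt y.1) (fun y => htgtne y.1) rfl
  have hB' : ∀ᶠ m in (p : Filter ℤ), ∀ s ∈ J, k s + m ∈ B :=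
    (eventually_all_finset J).2 hkB
  obtain ⟨m, ⟨z, hz, hzV⟩, hm⟩ := (key.and hB').exists
  set y := (φ y₁ m)⁻¹ • z with hy
  have hall : ∀ w, φ w m • y ∈ tgt w := by
    intro w
    by_cases hw : w = y₁
    · subst hw
      rwa [hy, smul_inv_smul]
    · have := hzV ⟨w, hw⟩
      rwa [hy, smul_smul, ← div_eq_mul_inv]
  obtain ⟨s, hs, hsU⟩ := hJ y
  refine hm s hs ⟨s • y, hsU, fun i => ?_⟩
  rw [add_comm]
  by_cases hi : g i ∈ polyMaps Γ 1
  · have h1 : g i (m + 0) • y ∈ W i := hall (Sum.inr ⟨i, hi⟩)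
    have h2 := (hW i).2.2 hi s hs _ h1
    rw [add_zero, smul_smul, smul_smul, mul_assoc, ← apply_add_of_mem_polyMaps_one hi] at h2
    rwa [smul_smul, mul_comm]
  · have h1 : s • g i (m + k s) • y ∈ V i := hall (Sum.inl ⟨⟨i, hi⟩, ⟨s, hs⟩⟩)
    rw [smul_smul] at h1
    rwa [smul_smul, mul_comm]

end IPMixing

theorem theorem3p2 {X Γ : Type*} [MetricSpace X] [CompactSpace X]
    [CommGroup Γ] [TopologicalSpace Γ] [IsTopologicalGroup Γ] [T2Space Γ]
    [MulAction Γ X] [ContinuousSMul Γ X]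
    (n : ℕ → ℤ)
    (hΓ : ∀ T : Γ, T ≠ 1 → IPMixing.IsMinimalElement X T ∧ IPMixing.IsMixingAlong X n T)
    {d k : ℕ} (T : Fin d → Γ) (p : Fin k → Fin d → ℤ → ℤ)
    (hp : ∀ i j, IPMixing.IsIntegralPolynomial (p i j))
    (hg : ∀ i, IPMixing.DependsNontrivially (IPMixing.gammaPoly T (p i)))
    (hgg : ∀ i j, i ≠ j → IPMixing.DependsNontrivially
      (fun m => IPMixing.gammaPoly T (p i) m * (IPMixing.gammaPoly T (p j) m)⁻¹))
    (U : Set X) (hUo : IsOpen U) (hUne : U.Nonempty)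
    (V : Fin k → Set X) (hVo : ∀ i, IsOpen (V i)) (hVne : ∀ i, (V i).Nonempty) :
    {m : ℤ | (U ∩ ⋂ i, (fun x : X => IPMixing.gammaPoly T (p i) m • x) ⁻¹' V i).Nonempty} ∈
      IPMixing.dualFamily (IPMixing.ipFamily n) := by
  open IPMixing Filter in
  rintro A ⟨R, hR, hRA⟩
  obtain ⟨q, hq, hqR, hqD⟩ := exists_idempotent_ultrafilter n hR
  suffices h : ∀ᶠ m in q, ∃ x ∈ U, ∀ i, gammaPoly T (p i) m • x ∈ V i by
    obtain ⟨m, ⟨x, hxU, hxV⟩, hm⟩ := (h.and hqR).exists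
    exact ⟨m, ⟨x, hxU, Set.mem_iInter.2 hxV⟩, hRA hm⟩
  rcases isEmpty_or_nonempty (Fin k) with hk | ⟨⟨i₀⟩⟩
  · obtain ⟨x, hx⟩ := hUne
    exact .of_forall fun m => ⟨x, hx, fun i => hk.elim i⟩
  rcases subsingleton_or_nontrivial X with hX | hX
  · obtain ⟨x, hx⟩ := hUne
    refine .of_forall fun m => ⟨x, hx, fun i => ?_⟩
    obtain ⟨v, hv⟩ := hVne i
    rwa [Subsingleton.elim (gammaPoly T (p i) m • x) v]
  have : Nontrivial Γ := by
    obtain ⟨m, m', h⟩ := hg i₀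
    exact ⟨_, _, h⟩
  obtain ⟨S, hS⟩ := exists_ne (1 : Γ)
  have : MulAction.IsMinimal Γ X := ⟨fun x => ((hΓ S hS).1.dense_orbit x).mono <| by
    rintro _ ⟨c, rfl⟩
    exact ⟨(c : Γ), rfl⟩⟩
  have hmix : IsMixingUltrafilter Γ X q :=
    ⟨hq, fun T hT U V hU hUne hV hVne => hqD _ ((hΓ T hT).2 U V hU hUne hV hVne)⟩
  choose D hD using fun i => exists_gammaPoly_mem_polyMaps T (hp i)
  refine (hmix.eventually_exists (D := Finset.univ.sup D)
    (g := fun i : ULift (Fin k) => gammaPoly T (p i.down)) (V := fun i => V i.down)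
    (fun i => polyMaps_mono (Finset.le_sup (Finset.mem_univ _)) (hD i.down))
    (fun i => dependsNontrivially_iff.1 (hg i.down)) (fun i j hij => ?_) hUo hUne
    (fun i => hVo _) (fun i => hVne _)).mono fun m ⟨x, hx, h⟩ => ⟨x, hx, fun i => h ⟨i⟩⟩
  have := dependsNontrivially_iff.1 (hgg i.down j.down fun h => hij (ULift.ext _ _ h))
  rwa [div_eq_mul_inv]
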